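/- **Setting.** A directed simplicial complex $X$ on a finite vertex set $V$ is a family of non-empty tuples $(x_0,\dots,x_n)$ of elements of $V$ (repetitions allowed) that is closed under deleting an entry from a tuple of length at least two; tuples of length $n+1$ are its $n$-simplices. A filtration of $X$, indexed by a set $T\subseteq\mathbb R$, is a family $(X_\delta)_{\delta\in T}$ of subcomplexes with $X_\delta\subseteq X_{\delta'}$ for $\delta\le\delta'$ and $X=\bigcup_{\delta\in T}X_\delta$. For a semiring $R$ let $C_n(X,R)$ be the free $R$-semimodule on the $n$-simplices, let $\partial^+$ and $\partial^-$ send an $n$-simplex ($n\ge1$) to the sum of its faces obtained by deleting an entry of even, respectively odd, index (both are zero for $n=0$), let $Z_n(X,R)=\{x\in C_n(X,R)\mid\partial^+x=\partial^-x\}$, and let $H_n(X,R)$ be the quotient of $Z_n(X,R)$ by the congruence: $x\sim y$ if and only if $x+\partial^+u+\partial^-v=y+\partial^+v+\partial^-u$ for some $u,v\in C_{n+1}(X,R)$. Let $\Lambda$ be a cancellative semiring whose ring completion (Grothendieck ring) $K(\Lambda)$ is a field. Let $H_n^{\mathrm{Dir}}(X,K(\Lambda))$ be the $K(\Lambda)$-subspace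 of $H_n(X,K(\Lambda))$ generated by the image of the canonical map $H_n(X,\Lambda)\to H_n(X,K(\Lambda))$. For a filtration, the spaces $H_n(X_\delta,K(\Lambda))$ and $H_n^{\mathrm{Dir}}(X_\delta,K(\Lambda))$, $\delta\in T$, with the maps induced by the inclusions, form the undirected and the directed $n$-dimensional persistence module. Compatible bases of a persistence module $(\{V^\delta\},\{\nu_\delta^{\delta'}\})_{\delta\le\delta'\in T}$ over a field are bases $B_\delta$ of the $V^\delta$ such that every $\nu_\delta^{\delta'}$ maps $B_\delta$ into $B_{\delta'}\cup\{0\}$ and no two elements of $B_\delta$ to the same element of $B_{\delta'}$. A bar is a class of basis elements, where each $b\in B_\delta$ is identified with $\nu_\delta^{\delta'}(b)$ whenever the latter is in $B_{\delta'}$; it represents the interval of all times $\delta\in T$ at which it has a representative. The barcode is the family of these bars (the multiset of their intervals). Two bars die at the same time if the same elements of $T$ lie strictly after all times of the one and of the other; a bar is born no later than another if every element of $T$ that lies strictly before all times of the first lies strictly before all times of the second. **Proposition.** Let $(X_\delta)_{\delta\in T}$, $T\subseteq\mathbb R$, be a filtration of a directed simplicial complex $X$ on a finite vertex set, let $\Lambda$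 be a cancellative semiring such that $K(\Lambda)$ is a field, and let $n\ge0$. The directed and the undirected $n$-dimensional persistence modules have compatible bases, hence barcodes $\operatorname{Pers}_n^{\mathrm{Dir}}(X,\Lambda)$ and $\operatorname{Pers}_n(X,\Lambda)$. The inclusions $H_n^{\mathrm{Dir}}(X_\delta,K(\Lambda))\hookrightarrow H_n(X_\delta,K(\Lambda))$ form a monomorphism of persistence modules, and, for any choice of compatible bases, there is an injective map $\sigma$ from the bars of $\operatorname{Pers}_n^{\mathrm{Dir}}(X,\Lambda)$ to the bars of $\operatorname{Pers}_n(X,\Lambda)$ such that every bar $\beta$ and its match $\sigma(\beta)$ die at the same time and $\sigma(\beta)$ is born no later than $\beta$. Moreover $\sigma$ can be taken to be the matching induced by this monomorphism: among the bars with a given death, the $i$-th directed bar in order of birth is matched with the $i$-th undirected bar in order of birth (in any order among bars with equal birth and death). -/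

import Mathlib

universe u v w

noncomputable section

/-! ### The ring completion of a semiring -/

/-- The ring completion `K(Λ)` of a semiring: the Grothendieck group of `(Λ, +)`, whose elements are
the formal differences `[x₁, x₂] = k(x₁) - k(x₂)`. -/
def RingCompletion (Λ : Type v) [Semiring Λ] : Type v :=
  Algebra.GrothendieckAddGroup Λ

namespace RingCompletion

variable {Λ : Type v} [Semiring Λ]

instance : AddCommGroup (RingCompletion Λ) :=
  inferInstanceAs (AddCommGroup (Algebra.GrothendieckAddGroup Λ))

/-- The canonical additive map `k : Λ → K(Λ)`, `x ↦ [x, 0]`. -/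
def ofAdd : Λ →+ RingCompletion Λ :=
  Algebra.GrothendieckAddGroup.of

/-- The biadditive extension of the multiplication of `Λ`. -/
def mulHom : RingCompletion Λ →+ RingCompletion Λ →+ RingCompletion Λ :=
  Algebra.GrothendieckAddGroup.lift (M := Λ) (G := RingCompletion Λ →+ RingCompletion Λ)
    { toFun := fun a =>
        Algebra.GrothendieckAddGroup.lift (M := Λ) (G := RingCompletion Λ)
          (ofAdd.comp (AddMonoidHom.mulLeft a))
      map_zero' := by
        apply Algebra.GrothendieckAddGroup.lift.symm.injective
        rw [Equiv.symm_apply_apply]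
        ext x
        change ofAdd (0 * x) = 0
        rw [zero_mul, map_zero]
      map_add' := fun a b => by
        apply Algebra.GrothendieckAddGroup.lift.symm.injective
        rw [Equiv.symm_apply_apply]
        have h : ∀ c x : Λ, (Algebra.GrothendieckAddGroup.lift (M := Λ) (G := RingCompletion Λ)
            (ofAdd.comp (AddMonoidHom.mulLeft c))) (ofAdd x) = ofAdd (c * x) := fun c x =>
          DFunLike.congr_fun (Algebra.GrothendieckAddGroup.lift.symm_apply_apply
            (ofAdd.comp (AddMonoidHom.mulLeft c))) x
        ext x
        change ofAdd ((a + b) * x) = _ + _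
        rw [add_mul, map_add]
        exact congrArg₂ (· + ·) (h a x).symm (h b x).symm }

instance : Mul (RingCompletion Λ) := ⟨fun x y => mulHom x y⟩

instance : One (RingCompletion Λ) := ⟨ofAdd 1⟩

theorem ofAdd_mul (a b : Λ) : (ofAdd (a * b) : RingCompletion Λ) = ofAdd a * ofAdd b := by
  have h1 : mulHom (ofAdd a) = _ := DFunLike.congr_fun
    (Algebra.GrothendieckAddGroup.lift.symm_apply_apply (_ : Λ →+ _)) a
  change _ = mulHom (ofAdd a) (ofAdd b)
  rw [h1]
  exact (DFunLike.congr_fun (Algebra.GrothendieckAddGroup.lift.symm_apply_apply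
    (ofAdd.comp (AddMonoidHom.mulLeft a))) b).symm

/-- Two additive maps out of `K(Λ)` that agree on `Λ` are equal. -/
theorem hom_ext {G : Type*} [AddCommGroup G] {f g : RingCompletion Λ →+ G}
    (h : ∀ a, f (ofAdd a) = g (ofAdd a)) : f = g :=
  Algebra.GrothendieckAddGroup.lift.symm.injective (AddMonoidHom.ext h)

theorem mul_def' (x y : RingCompletion Λ) : x * y = mulHom x y := rfl

instance : Ring (RingCompletion Λ) :=
  { (inferInstance : AddCommGroup (RingCompletion Λ)),
    (inferInstance : Mul (RingCompletion Λ)),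
    (inferInstance : One (RingCompletion Λ)) with
    left_distrib := fun x y z => map_add (mulHom x) y z
    right_distrib := fun x y z => by simp only [mul_def', map_add, AddMonoidHom.add_apply]
    zero_mul := fun x => by simp only [mul_def', map_zero, AddMonoidHom.zero_apply]
    mul_zero := fun x => map_zero (mulHom x)
    one_mul := fun x => by
      have : mulHom (1 : RingCompletion Λ) = AddMonoidHom.id _ := hom_ext fun a => by
        change ofAdd 1 * ofAdd a = ofAdd a
        rw [← ofAdd_mul, one_mul]
      exact DFunLike.congr_fun this x
    mul_one := fun x => by
      have : mulHom.flip (1 : RingCompletion Λ) = AddMonoidHom.id _ := hom_ext fun a => by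
        change ofAdd a * ofAdd 1 = ofAdd a
        rw [← ofAdd_mul, mul_one]
      exact DFunLike.congr_fun this x
    mul_assoc := fun x y z => by
      have h1 : ∀ a b : Λ, mulHom ((ofAdd a : RingCompletion Λ) * ofAdd b) =
          (mulHom (ofAdd a)).comp (mulHom (ofAdd b)) := fun a b => hom_ext fun c => by
        change ofAdd a * ofAdd b * ofAdd c = ofAdd a * (ofAdd b * ofAdd c)
        simp only [← ofAdd_mul, mul_assoc]
      have h2 : ∀ a : Λ, mulHom.comp (mulHom (ofAdd a : RingCompletion Λ)) =
          (AddMonoidHom.compHom (mulHom (ofAdd a))).comp mulHom := fun a => hom_ext fun b => h1 a b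
      have h3 : (AddMonoidHom.compHom mulHom).comp mulHom =
          ((AddMonoidHom.compHom (M := RingCompletion Λ)).flip mulHom).comp
            ((AddMonoidHom.compHom (M := RingCompletion Λ) (N := RingCompletion Λ)
              (P := RingCompletion Λ)).comp mulHom) := hom_ext fun a => h2 a
      exact DFunLike.congr_fun (DFunLike.congr_fun (DFunLike.congr_fun h3 x) y) z }

/-- The canonical morphism of semirings `k : Λ → K(Λ)`. -/
def of : Λ →+* RingCompletion Λ :=
  { ofAdd with
    map_one' := rfl
    map_mul' := ofAdd_mul }

end RingCompletion

/-! ### Directed simplicial complexes and their homology -/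

/-- A directed simplicial complex (ordered tuple complex) with vertices in `V`: for every `n` a set
of `(n+1)`-tuples of vertices, repetitions allowed, closed under deleting an entry. Its vertex set
consists of the `v` for which the one-element tuple `(v)` is a simplex. -/
@[ext]
structure DirectedComplex (V : Type u) where
  simplices : (n : ℕ) → Set (Fin (n + 1) → V)
  face_mem : ∀ {n : ℕ} {σ : Fin (n + 2) → V}, σ ∈ simplices (n + 1) →
    ∀ i : Fin (n + 2), σ ∘ i.succAbove ∈ simplices n

namespace DirectedComplex

variable {V : Type u}

/-- `X ≤ Y` means that `X` is a subcomplex of `Y`. -/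
instance : LE (DirectedComplex V) := ⟨fun X Y => ∀ n, X.simplices n ⊆ Y.simplices n⟩

/-- The `i`-th face of a simplex. -/
def face (X : DirectedComplex V) {n : ℕ} (σ : X.simplices (n + 1)) (i : Fin (n + 2)) :
    X.simplices n :=
  ⟨σ.1 ∘ i.succAbove, X.face_mem σ.2 i⟩

section Chains

variable (X Y Z : DirectedComplex V) (R : Type v)

/-- The `n`-chains `C_n(X, R)`: the free `R`-semimodule on the `n`-simplices. -/
abbrev Chain [Semiring R] (n : ℕ) : Type (max u v) := X.simplices n →₀ R

variable [Semiring R]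

/-- The positive differential `∂⁺_{n+1}`: the sum of the faces of even index. -/
def boundaryPos (n : ℕ) : X.Chain R (n + 1) →ₗ[R] X.Chain R n :=
  Finsupp.linearCombination R fun σ =>
    ∑ i ∈ Finset.univ.filter (fun i : Fin (n + 2) => Even (i : ℕ)),
      Finsupp.single (X.face σ i) (1 : R)

/-- The negative differential `∂⁻_{n+1}`: the sum of the faces of odd index. -/
def boundaryNeg (n : ℕ) : X.Chain R (n + 1) →ₗ[R] X.Chain R n :=
  Finsupp.linearCombination R fun σ =>
    ∑ i ∈ Finset.univ.filter (fun i : Fin (n + 2) => Odd (i : ℕ)),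
      Finsupp.single (X.face σ i) (1 : R)

/-- The cycles `Z_n(X, R) = {x | ∂⁺x = ∂⁻x}`; both differentials are zero in degree `0`. -/
def cycles : (n : ℕ) → Submodule R (X.Chain R n)
  | 0 => ⊤
  | n + 1 => LinearMap.eqLocus (X.boundaryPos R n) (X.boundaryNeg R n)

/-- The congruence `ρ_n` on the cycles: `x ∼ y` if there are chains `a`, `b` with
`x + ∂⁺a + ∂⁻b = y + ∂⁺b + ∂⁻a`. -/
def homologyCon (n : ℕ) : ModuleCon R (X.cycles R n) where
  r x y := ∃ a b : X.Chain R (n + 1),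
    (x : X.Chain R n) + X.boundaryPos R n a + X.boundaryNeg R n b =
      (y : X.Chain R n) + X.boundaryPos R n b + X.boundaryNeg R n a
  iseqv :=
    { refl := fun x => ⟨0, 0, rfl⟩
      symm := fun {x y} ⟨a, b, h⟩ => ⟨b, a, h.symm⟩
      trans := fun {x y z} ⟨a, b, h⟩ ⟨a', b', h'⟩ => ⟨a + a', b + b', by
        calc (x : X.Chain R n) + X.boundaryPos R n (a + a') + X.boundaryNeg R n (b + b')
            = (x + X.boundaryPos R n a + X.boundaryNeg R n b)
              + (X.boundaryPos R n a' + X.boundaryNeg R n b') := by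
              rw [map_add, map_add]; abel
          _ = (y + X.boundaryPos R n a' + X.boundaryNeg R n b')
              + (X.boundaryPos R n b + X.boundaryNeg R n a) := by rw [h]; abel
          _ = _ := by rw [h', map_add, map_add]; abel⟩ }
  add' := fun {x y x' y'} ⟨a, b, h⟩ ⟨a', b', h'⟩ => ⟨a + a', b + b', by
    calc ((x + x' : X.cycles R n) : X.Chain R n) + X.boundaryPos R n (a + a')
          + X.boundaryNeg R n (b + b')
        = (x + X.boundaryPos R n a + X.boundaryNeg R n b)
          + (x' + X.boundaryPos R n a' + X.boundaryNeg R n b') := by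
          rw [map_add, map_add, Submodule.coe_add]; abel
      _ = _ := by rw [h, h', map_add, map_add, Submodule.coe_add]; abel⟩
  smul := fun c {x y} ⟨a, b, h⟩ => ⟨c • a, c • b, by
    simpa only [map_smul, Submodule.coe_smul, smul_add] using congrArg (c • ·) h⟩

/-- The homology semimodule `H_n(X, R) = Z_n(X, R) / ρ_n`. -/
def Homology (n : ℕ) : Type (max u v) := (X.homologyCon R n).Quotient

instance (n : ℕ) : AddCommMonoid (X.Homology R n) :=
  inferInstanceAs (AddCommMonoid (X.homologyCon R n).Quotient)

instance (n : ℕ) : Module R (X.Homology R n) :=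
  inferInstanceAs (Module R (X.homologyCon R n).Quotient)

/-- The homology class of a cycle. -/
def homologyClass (n : ℕ) : X.cycles R n →ₗ[R] X.Homology R n where
  toFun x := (X.homologyCon R n).toAddCon.mk' x
  map_add' _ _ := rfl
  map_smul' _ _ := rfl

end Chains

/-- Over a ring the homology semimodule is an abelian group. -/
instance (X : DirectedComplex V) (S : Type v) [Ring S] (n : ℕ) : AddCommGroup (X.Homology S n) :=
  Module.addCommMonoidToAddCommGroup S

section Functoriality

variable {X Y Z : DirectedComplex V} {R : Type v} [Semiring R]

theorem homologyClass_surjective (n : ℕ) : Function.Surjective (X.homologyClass R n) :=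
  Quotient.mk_surjective

theorem homologyClass_eq_iff {n : ℕ} {x y : X.cycles R n} :
    X.homologyClass R n x = X.homologyClass R n y ↔ (X.homologyCon R n).r x y :=
  (X.homologyCon R n).toAddCon.eq

/-- The map `C_n(i)` induced by the inclusion `i : X → Y` of a subcomplex. -/
def chainMap (R : Type v) [Semiring R] (h : X ≤ Y) (n : ℕ) : X.Chain R n →ₗ[R] Y.Chain R n :=
  Finsupp.lmapDomain R R (Set.inclusion (h n))

theorem chainMap_boundaryPos (h : X ≤ Y) (n : ℕ) (x : X.Chain R (n + 1)) :
    chainMap R h n (X.boundaryPos R n x) = Y.boundaryPos R n (chainMap R h (n + 1) x) := by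
  refine DFunLike.congr_fun (f := (chainMap R h n).comp (X.boundaryPos R n))
    (g := (Y.boundaryPos R n).comp (chainMap R h (n + 1))) ?_ x
  ext σ : 2
  simp only [LinearMap.comp_apply, Finsupp.lsingle_apply, boundaryPos, chainMap,
    Finsupp.lmapDomain_apply, Finsupp.mapDomain_single, Finsupp.linearCombination_single, one_smul]
  simp only [← Finsupp.lmapDomain_apply R R, map_sum]
  simp only [Finsupp.lmapDomain_apply, Finsupp.mapDomain_single]
  rfl

theorem chainMap_boundaryNeg (h : X ≤ Y) (n : ℕ) (x : X.Chain R (n + 1)) :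
    chainMap R h n (X.boundaryNeg R n x) = Y.boundaryNeg R n (chainMap R h (n + 1) x) := by
  refine DFunLike.congr_fun (f := (chainMap R h n).comp (X.boundaryNeg R n))
    (g := (Y.boundaryNeg R n).comp (chainMap R h (n + 1))) ?_ x
  ext σ : 2
  simp only [LinearMap.comp_apply, Finsupp.lsingle_apply, boundaryNeg, chainMap,
    Finsupp.lmapDomain_apply, Finsupp.mapDomain_single, Finsupp.linearCombination_single, one_smul]
  simp only [← Finsupp.lmapDomain_apply R R, map_sum]
  simp only [Finsupp.lmapDomain_apply, Finsupp.mapDomain_single]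
  rfl

theorem chainMap_mem_cycles (h : X ≤ Y) : ∀ (n : ℕ) (x : X.Chain R n), x ∈ X.cycles R n →
    chainMap R h n x ∈ Y.cycles R n
  | 0, _, _ => Submodule.mem_top
  | n + 1, x, hx => by
    change Y.boundaryPos R n _ = Y.boundaryNeg R n _
    rw [← chainMap_boundaryPos, ← chainMap_boundaryNeg]
    exact congrArg _ hx

/-- The map induced on cycles by the inclusion of a subcomplex. -/
def cyclesMap (R : Type v) [Semiring R] (h : X ≤ Y) (n : ℕ) : X.cycles R n →ₗ[R] Y.cycles R n :=
  (chainMap R h n).restrict (chainMap_mem_cycles h n)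

/-- The map `H_n(i)` induced on homology by the inclusion `i : X → Y` of a subcomplex. -/
def homologyMap (R : Type v) [Semiring R] (h : X ≤ Y) (n : ℕ) :
    X.Homology R n →ₗ[R] Y.Homology R n where
  toFun := Quotient.lift (fun x => Y.homologyClass R n (cyclesMap R h n x)) (by
    rintro x y ⟨a, b, hab⟩
    refine homologyClass_eq_iff.2 ⟨chainMap R h _ a, chainMap R h _ b, ?_⟩
    simp only [← chainMap_boundaryPos, ← chainMap_boundaryNeg]
    have := congrArg (chainMap R h n) hab
    simp only [map_add] at this
    exact this)
  map_add' x y := by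
    obtain ⟨x, rfl⟩ := homologyClass_surjective n x
    obtain ⟨y, rfl⟩ := homologyClass_surjective n y
    exact map_add ((Y.homologyClass R n).comp (cyclesMap R h n)) x y
  map_smul' c x := by
    obtain ⟨x, rfl⟩ := homologyClass_surjective n x
    exact map_smul ((Y.homologyClass R n).comp (cyclesMap R h n)) c x

theorem homologyMap_class (h : X ≤ Y) (n : ℕ) (x : X.cycles R n) :
    homologyMap R h n (X.homologyClass R n x) = Y.homologyClass R n (cyclesMap R h n x) := rfl

theorem homologyMap_id (h : X ≤ X) (n : ℕ) (x : X.Homology R n) : homologyMap R h n x = x := by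
  obtain ⟨x, rfl⟩ := homologyClass_surjective n x
  rw [homologyMap_class]
  congr 1
  exact Subtype.ext (Finsupp.mapDomain_id)

theorem homologyMap_comp (h : X ≤ Y) (h' : Y ≤ Z) (h'' : X ≤ Z) (n : ℕ) (x : X.Homology R n) :
    homologyMap R h' n (homologyMap R h n x) = homologyMap R h'' n x := by
  obtain ⟨x, rfl⟩ := homologyClass_surjective n x
  simp only [homologyMap_class]
  congr 1
  exact Subtype.ext (Finsupp.mapDomain_comp (f := Set.inclusion (h n))
    (g := Set.inclusion (h' n))).symm

end Functoriality

/-! ### Directed homology -/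

section Directed

variable (X : DirectedComplex V) (Λ : Type v) [Semiring Λ]

/-- The canonical map `C_n(X, Λ) → C_n(X, K(Λ))`, which applies `k : Λ → K(Λ)` to the coefficients;
under `C_n(X, K(Λ)) ≅ K(C_n(X, Λ))` it is `x ↦ [x, 0]`. -/
def completionChain (n : ℕ) : X.Chain Λ n →+ X.Chain (RingCompletion Λ) n :=
  Finsupp.mapRange.addMonoidHom (RingCompletion.of (Λ := Λ)).toAddMonoidHom

variable {Λ}

theorem completionChain_single (n : ℕ) (σ : X.simplices n) (a : Λ) :
    X.completionChain Λ n (Finsupp.single σ a) = Finsupp.single σ (RingCompletion.of a) :=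
  Finsupp.mapRange_single (hf := map_zero _)

theorem completionChain_boundaryPos (n : ℕ) (x : X.Chain Λ (n + 1)) :
    X.completionChain Λ n (X.boundaryPos Λ n x) =
      X.boundaryPos (RingCompletion Λ) n (X.completionChain Λ (n + 1) x) := by
  refine DFunLike.congr_fun
    (f := (X.completionChain Λ n).comp (X.boundaryPos Λ n).toAddMonoidHom)
    (g := (X.boundaryPos (RingCompletion Λ) n).toAddMonoidHom.comp
      (X.completionChain Λ (n + 1))) ?_ x
  ext σ a : 2
  simp only [AddMonoidHom.comp_apply, LinearMap.toAddMonoidHom_coe, Finsupp.singleAddHom_apply,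
    completionChain_single, boundaryPos, Finsupp.linearCombination_single, Finset.smul_sum, map_sum,
    Finsupp.smul_single, smul_eq_mul, mul_one]

theorem completionChain_boundaryNeg (n : ℕ) (x : X.Chain Λ (n + 1)) :
    X.completionChain Λ n (X.boundaryNeg Λ n x) =
      X.boundaryNeg (RingCompletion Λ) n (X.completionChain Λ (n + 1) x) := by
  refine DFunLike.congr_fun
    (f := (X.completionChain Λ n).comp (X.boundaryNeg Λ n).toAddMonoidHom)
    (g := (X.boundaryNeg (RingCompletion Λ) n).toAddMonoidHom.comp
      (X.completionChain Λ (n + 1))) ?_ x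
  ext σ a : 2
  simp only [AddMonoidHom.comp_apply, LinearMap.toAddMonoidHom_coe, Finsupp.singleAddHom_apply,
    completionChain_single, boundaryNeg, Finsupp.linearCombination_single, Finset.smul_sum, map_sum,
    Finsupp.smul_single, smul_eq_mul, mul_one]

theorem completionChain_mem_cycles : ∀ (n : ℕ) (x : X.Chain Λ n), x ∈ X.cycles Λ n →
    X.completionChain Λ n x ∈ X.cycles (RingCompletion Λ) n
  | 0, _, _ => Submodule.mem_top
  | n + 1, x, hx => by
    change X.boundaryPos _ n _ = X.boundaryNeg _ n _
    rw [← completionChain_boundaryPos, ← completionChain_boundaryNeg]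
    exact congrArg _ hx

variable (Λ)

/-- The map `H_n(k_X) : H_n(X, Λ) → H_n(X, K(Λ))`, which sends the class of `x` to the class of
`[x, 0]`. -/
def completionHomology (n : ℕ) : X.Homology Λ n → X.Homology (RingCompletion Λ) n :=
  Quotient.lift (fun x => X.homologyClass (RingCompletion Λ) n
      ⟨X.completionChain Λ n x.1, X.completionChain_mem_cycles n x.1 x.2⟩) (by
    rintro x y ⟨a, b, hab⟩
    refine homologyClass_eq_iff.2 ⟨X.completionChain Λ _ a, X.completionChain Λ _ b, ?_⟩
    simp only [← completionChain_boundaryPos, ← completionChain_boundaryNeg]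
    have := congrArg (X.completionChain Λ n) hab
    simpa only [map_add] using this)

/-- The directed homology `H_n^Dir(X, K(Λ))`: the `K(Λ)`-submodule of `H_n(X, K(Λ))` generated by
the image of `H_n(k_X)`. -/
def directedHomology (n : ℕ) : Submodule (RingCompletion Λ) (X.Homology (RingCompletion Λ) n) :=
  Submodule.span (RingCompletion Λ) (Set.range (X.completionHomology Λ n))

variable {X Λ} {Y : DirectedComplex V}

theorem homologyMap_completionHomology (h : X ≤ Y) (n : ℕ) (x : X.Homology Λ n) :
    homologyMap (RingCompletion Λ) h n (X.completionHomology Λ n x) =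
      Y.completionHomology Λ n (homologyMap Λ h n x) := by
  obtain ⟨x, rfl⟩ := homologyClass_surjective n x
  change Y.homologyClass _ n _ = Y.homologyClass _ n _
  congr 1
  apply Subtype.ext
  exact Finsupp.mapDomain_mapRange (Set.inclusion (h n)) x.1
    (RingCompletion.of (Λ := Λ)) (map_zero _) (map_add _)

theorem homologyMap_mem_directed (h : X ≤ Y) (n : ℕ) (x : X.Homology (RingCompletion Λ) n)
    (hx : x ∈ X.directedHomology Λ n) :
    homologyMap (RingCompletion Λ) h n x ∈ Y.directedHomology Λ n := by
  have : X.directedHomology Λ n ≤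
      (Y.directedHomology Λ n).comap (homologyMap (RingCompletion Λ) h n) := by
    refine Submodule.span_le.2 ?_
    rintro _ ⟨y, rfl⟩
    refine Submodule.subset_span ⟨homologyMap Λ h n y, ?_⟩
    rw [homologyMap_completionHomology]
  exact this hx

end Directed

end DirectedComplex

/-! ### Persistence modules and their barcodes -/

/-- A persistence `R`-module over an ordered index set `T`. -/
structure PersistenceModule (R : Type v) [Ring R] (T : Type w) [Preorder T] where
  obj : T → Type u
  [addCommGroup : ∀ t, AddCommGroup (obj t)]
  [module : ∀ t, Module R (obj t)]
  map : ∀ {s t : T}, s ≤ t → obj s →ₗ[R] obj t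
  map_self : ∀ (t : T) (x : obj t), map le_rfl x = x
  map_map : ∀ {r s t : T} (h : r ≤ s) (h' : s ≤ t) (x : obj r),
    map h' (map h x) = map (h.trans h') x

namespace PersistenceModule

attribute [instance] addCommGroup module

variable {R : Type v} [Ring R] {T : Type w} [Preorder T]

/-- A morphism of persistence modules. -/
structure Hom (M N : PersistenceModule.{u} R T) where
  app : ∀ t, M.obj t →ₗ[R] N.obj t
  naturality : ∀ {s t : T} (h : s ≤ t) (x : M.obj s), app t (M.map h x) = N.map h (app s x)

/-- Compatible bases of a persistence module: a basis `B_t` of each space such that the structure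
maps send each basis element to a basis element or to zero, and no two elements of `B_s` to the
same element of `B_t`. -/
structure CompatibleBases (M : PersistenceModule.{u} R T) where
  B : ∀ t, Set (M.obj t)
  linearIndependent : ∀ t, LinearIndependent R ((↑) : B t → M.obj t)
  span_eq_top : ∀ t, Submodule.span R (B t) = ⊤
  map_mem : ∀ {s t : T} (h : s ≤ t), ∀ b ∈ B s, M.map h b ∈ B t ∨ M.map h b = 0
  map_inj : ∀ {s t : T} (h : s ≤ t), ∀ b ∈ B s, ∀ b' ∈ B s,
    M.map h b ∈ B t → M.map h b = M.map h b' → b = b'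

namespace CompatibleBases

variable {M : PersistenceModule.{u} R T} (𝓑 : M.CompatibleBases)

/-- The bars of the barcode, counted with multiplicity: basis elements over all times, where an
element is identified with the basis elements to which it is mapped at later times. If `T` is
finite, every bar has exactly one earliest representative `(b, t)`, the one for which `b` is not in
the image of any earlier basis. -/
def Bar : Type (max u w) :=
  Quot fun (p q : Σ t, 𝓑.B t) => ∃ h : p.1 ≤ q.1, M.map h p.2 = q.2

/-- The interval of `T` that a bar represents: all times at which it has a representative. If `T` is
the finite set `δ_0 < ⋯ < δ_m`, this is `[δ_i, δ_{j+1}) ∩ T` (or `[δ_i, ∞) ∩ T`) for the bar born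
at `δ_i` whose last representative is at `δ_j`. -/
def life (β : 𝓑.Bar) : Set T := {t | ∃ b : 𝓑.B t, Quot.mk _ ⟨t, b⟩ = β}

end CompatibleBases

end PersistenceModule

/-- The times before the birth of an interval. -/
def timesBefore {T : Type w} [Preorder T] (I : Set T) : Set T := {t | ∀ s ∈ I, t < s}

/-- The times from the death of an interval on. For a finite set `T` of reals and `I` given by
`[δ_i, δ_{j+1})`, its least element is the death time `δ_{j+1}`, and it is empty if the death time
is `+∞`. -/
def timesAfter {T : Type w} [Preorder T] (I : Set T) : Set T := {t | ∀ s ∈ I, s < t}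

/-- Two intervals die at the same time. -/
def SameDeath {T : Type w} [Preorder T] (I J : Set T) : Prop := timesAfter I = timesAfter J

/-- The interval `I` is born before `J` or at the same time. -/
def BornNoLater {T : Type w} [Preorder T] (I J : Set T) : Prop := timesBefore I ⊆ timesBefore J

/-- The matching of bars that a monomorphism of persistence modules induces: an injective map `σ`
that sends each bar to a bar with the same death, born no later, and that matches, among the bars
with a given death, in order of birth: the earliest-born with the earliest-born, the second with
the second, and so on (in any order among bars with the same birth and death). -/
structure IsInducedMatching {T : Type w} [Preorder T] {α β : Type*} (I : α → Set T)
    (J : β → Set T) (σ : α → β) : Prop where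
  injective : Function.Injective σ
  sameDeath : ∀ a, SameDeath (I a) (J (σ a))
  bornNoLater : ∀ a, BornNoLater (J (σ a)) (I a)
  monotone : ∀ a a', SameDeath (I a) (I a') → ¬ BornNoLater (I a') (I a) →
    BornNoLater (J (σ a)) (J (σ a'))
  initial : ∀ a b, SameDeath (J b) (J (σ a)) → ¬ BornNoLater (J (σ a)) (J b) → b ∈ Set.range σ

/-! ### Filtrations -/

/-- A filtration of a directed simplicial complex `X`, indexed by a set `T` of reals. -/
structure DirectedFiltration {V : Type u} (X : DirectedComplex V) (T : Set ℝ) where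
  complex : T → DirectedComplex V
  mono : ∀ {s t : T}, s ≤ t → complex s ≤ complex t
  union : ∀ n, X.simplices n = ⋃ t, (complex t).simplices n

namespace DirectedFiltration

variable {V : Type u} {X : DirectedComplex V} {T : Set ℝ} (F : DirectedFiltration X T)
  (Λ : Type v) [Semiring Λ] (n : ℕ)

/-- The `n`-dimensional undirected persistence `K(Λ)`-module of a filtration. -/
def undirected : PersistenceModule.{max u v} (RingCompletion Λ) T where
  obj t := (F.complex t).Homology (RingCompletion Λ) n
  map h := DirectedComplex.homologyMap (RingCompletion Λ) (F.mono h) n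
  map_self _ x := DirectedComplex.homologyMap_id _ n x
  map_map _ _ x := DirectedComplex.homologyMap_comp _ _ _ n x

/-- The `n`-dimensional directed persistence `K(Λ)`-module of a filtration. -/
def directed : PersistenceModule.{max u v} (RingCompletion Λ) T where
  obj t := (F.complex t).directedHomology Λ n
  map h := (DirectedComplex.homologyMap (RingCompletion Λ) (F.mono h) n).restrict
    (DirectedComplex.homologyMap_mem_directed (F.mono h) n)
  map_self _ x := Subtype.ext (DirectedComplex.homologyMap_id _ n x.1)
  map_map _ _ x := Subtype.ext (DirectedComplex.homologyMap_comp _ _ _ n x.1)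

/-- The inclusion of the directed into the undirected persistence module. -/
def inclusion : (F.directed Λ n).Hom (F.undirected Λ n) where
  app t := ((F.complex t).directedHomology Λ n).subtype
  naturality _ _ := rfl

end DirectedFiltration

end

/-! ### Matching finite families in order of birth -/

/-! The matching rests on a count. Fix an upper set `U` of times and a time `t` outside it. The
vectors at `t` that are killed at every time of `U`, modulo those already killed at some time
outside `U`, form a space whose dimension is the number of bars alive at `t` that die at `U`. A
levelwise injective morphism kills nothing new, so it induces injections of these quotients, and the
target has at least as many such bars (`encard_dyingAt_le`, carried out in coordinates).

Now sort the bars with a given death by birth on both sides and match by rank. If `t` lies in a bar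
of the source, every bar with the same death born no later is alive at `t` too, so by the count at
least as many target bars with this death are alive at `t`. Those are the earliest-born of their
class, hence the match is alive at `t`. Thus the match contains the bar and is born no later
(`exists_isInducedMatching`).

Compatible bases exist because on a finite vertex set the simplices in degrees `n` and `n + 1`
change only finitely often, which reduces the question to a finite chain of finite-dimensional
spaces. There an interval is split off at a time: a nonzero vector at the first nonzero time is
followed to the last time it survives, and a linear form equal to one on it there cuts out a
complementary persistence submodule of smaller total dimension
(`nonempty_compatibleBases_of_kernelAt`). -/

/-- A finite type with a function to a linear order can be enumerated in increasing order. -/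
theorem exists_equiv_fin_monotone {A L : Type*} [Finite A] [LinearOrder L] (f : A → L) :
    ∃ e : Fin (Nat.card A) ≃ A, Monotone (f ∘ e) := by
  let e := (Finite.equivFin A).symm
  refine ⟨(Tuple.sort (f ∘ e)).trans e, ?_⟩
  simpa [Function.comp_assoc] using Tuple.monotone_sort (f ∘ e)

/-- The matching of two finite families in increasing order. -/
theorem exists_sorted_matching {A B L : Type*} [Finite A] [Finite B] [LinearOrder L]
    (f : A → L) (g : B → L) (hAB : Nat.card A ≤ Nat.card B) :
    ∃ σ : A → B, Function.Injective σ ∧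
      (∀ a a', f a < f a' → g (σ a) ≤ g (σ a')) ∧
      (∀ a b, g b < g (σ a) → b ∈ Set.range σ) ∧
      (∀ a (s : Set B), (∀ b ∈ s, ∀ b', g b' ≤ g b → b' ∈ s) →
        {a' | f a' ≤ f a}.encard ≤ s.encard → σ a ∈ s) := by
  obtain ⟨e, he⟩ := exists_equiv_fin_monotone f
  obtain ⟨e', he'⟩ := exists_equiv_fin_monotone g
  refine ⟨fun a => e' (Fin.castLE hAB (e.symm a)), ?_, ?_, ?_, ?_⟩
  · exact e'.injective.comp ((Fin.castLE_injective hAB).comp e.symm.injective)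
  · intro a a' h
    refine he' ?_
    rw [Fin.castLE_le_castLE_iff]
    by_contra hlt
    have := he (le_of_not_ge hlt)
    simp only [Function.comp_apply, Equiv.apply_symm_apply] at this
    exact absurd h this.not_gt
  · intro a b h
    obtain ⟨j, rfl⟩ := e'.surjective b
    have hj : j < Fin.castLE hAB (e.symm a) := by
      by_contra hlt
      exact absurd h (he' (le_of_not_gt hlt)).not_gt
    have hj' : (j : ℕ) < Nat.card A := lt_trans (Fin.lt_def.1 hj) (e.symm a).2
    exact ⟨e ⟨j, hj'⟩, by simp⟩
  · intro a s hs hcard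
    by_contra hna
    set i := e.symm a with hi
    -- Position `i` of the sorted `B` is not in the lower set `s`, so no later position is: `s` has
    -- at most `i` elements. Positions `0, …, i` of the sorted `A` give `i + 1` elements of the
    -- sublevel set.
    have h1 : s ⊆ (fun j : Fin (i : ℕ) => e' ⟨j, by omega⟩) '' Set.univ := by
      intro b hb
      obtain ⟨j, rfl⟩ := e'.surjective b
      by_cases hj : (j : ℕ) < i
      · exact ⟨⟨j, hj⟩, trivial, rfl⟩
      · exact absurd (hs _ hb _ (he' (show Fin.castLE hAB i ≤ j from not_lt.1 hj))) hna
    have h2 : (fun j : Fin ((i : ℕ) + 1) => e ⟨j, by omega⟩) '' Set.univ ⊆ {a' | f a' ≤ f a} := by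
      rintro _ ⟨j, -, rfl⟩
      have := he (show (⟨j, by omega⟩ : Fin (Nat.card A)) ≤ i from Nat.lt_succ_iff.1 j.2)
      simpa [hi] using this
    have h3 := Set.encard_le_encard h2
    rw [Function.Injective.encard_image] at h3
    · have h4 := (h3.trans hcard).trans ((Set.encard_le_encard h1).trans (Set.encard_image_le _ _))
      simp only [Set.encard_univ, ENat.card_eq_coe_fintype_card, Fintype.card_fin] at h4
      have : (i : ℕ) + 1 ≤ i := by exact_mod_cast h4
      omega
    · intro j j' h
      have := e.injective h
      simpa [Fin.ext_iff] using this

/-! ### Intervals of a linear order compared by birth and death -/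

section Births

variable {T : Type w} [LinearOrder T]

/-- The times before the birth of an interval, as a lower set. -/
def birthCut (I : Set T) : LowerSet T :=
  ⟨timesBefore I, fun _ _ hba ha s hs => hba.trans_lt (ha s hs)⟩

theorem isUpperSet_timesAfter (I : Set T) : IsUpperSet (timesAfter I) :=
  fun _ _ hab ha s hs => (ha s hs).trans_le hab

/-- Births need not be attained in `T`; as lower sets of a linear order they are still linearly
ordered, so intervals can be sorted by them. -/
theorem birthCut_le_iff {I J : Set T} : birthCut I ≤ birthCut J ↔ BornNoLater I J := Iff.rfl

/-- A time that is neither before the birth nor after the death of an interval is in it. -/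
theorem mem_of_notMem_timesBefore_of_notMem_timesAfter {I : Set T} (hI : I.OrdConnected) {t : T}
    (h : t ∉ timesBefore I) (h' : t ∉ timesAfter I) : t ∈ I := by
  simp only [timesBefore, timesAfter, Set.mem_ofPred_eq, not_forall, not_lt] at h h'
  obtain ⟨s, hs, hst⟩ := h
  obtain ⟨u, hu, htu⟩ := h'
  exact hI.out hs hu ⟨hst, htu⟩

theorem notMem_timesBefore {I : Set T} {t : T} (h : t ∈ I) : t ∉ timesBefore I :=
  fun h' => lt_irrefl t (h' t h)

theorem notMem_timesAfter {I : Set T} {t : T} (h : t ∈ I) : t ∉ timesAfter I :=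
  fun h' => lt_irrefl t (h' t h)

/-- A time of an interval is a time of every interval with the same death that is born no later. -/
theorem mem_of_bornNoLater {I J : Set T} (hJ : J.OrdConnected) (hd : timesAfter I = timesAfter J)
    (hb : BornNoLater J I) {t : T} (ht : t ∈ I) : t ∈ J :=
  mem_of_notMem_timesBefore_of_notMem_timesAfter hJ (fun h => notMem_timesBefore ht (hb h))
    (hd ▸ notMem_timesAfter ht)

/-- Finitely many intervals with the same death have a common time. -/
theorem exists_mem_of_sameDeath {β : Type*} {J : β → Set T} (hne : ∀ b, (J b).Nonempty)
    (hconn : ∀ b, (J b).OrdConnected) {U : Set T} (s : Finset β) (hs : s.Nonempty)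
    (hU : ∀ b ∈ s, timesAfter (J b) = U) : ∃ t, ∀ b ∈ s, t ∈ J b := by
  -- The latest-born interval is contained in all others with the same death, so any of its times
  -- works.
  obtain ⟨b₀, hb₀, hmax⟩ := s.exists_max_image (fun b => birthCut (J b)) hs
  obtain ⟨t, ht⟩ := hne b₀
  exact ⟨t, fun b hb => mem_of_bornNoLater (hconn b) ((hU b₀ hb₀).trans (hU b hb).symm)
    (birthCut_le_iff.1 (hmax b hb)) ht⟩

/-- If at each time at most `d` intervals are alive, then at most `d` intervals share a death. -/
theorem encard_sameDeath_le {β : Type*} {J : β → Set T} (hne : ∀ b, (J b).Nonempty)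
    (hconn : ∀ b, (J b).OrdConnected) {U : Set T} {d : ℕ}
    (hd : ∀ t, {b | timesAfter (J b) = U ∧ t ∈ J b}.encard ≤ d) :
    {b | timesAfter (J b) = U}.encard ≤ d := by
  by_contra hlt
  have hle : ((d + 1 : ℕ) : ℕ∞) ≤ {b | timesAfter (J b) = U}.encard := by
    rw [Nat.cast_add_one]
    exact Order.add_one_le_of_lt (not_le.1 hlt)
  -- Exactly `d + 1` intervals are taken, since a common time is available only for finite families
  -- and the whole class might be infinite.
  obtain ⟨s, hsU, hs⟩ := Set.exists_subset_encard_eq hle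
  have hfin : s.Finite := Set.finite_of_encard_eq_coe hs
  have hsne : s.Nonempty := by
    rw [← Set.one_le_encard_iff_nonempty, hs]
    exact_mod_cast Nat.le_add_left 1 d
  obtain ⟨t, ht⟩ := exists_mem_of_sameDeath hne hconn (U := U) hfin.toFinset (by simpa using hsne)
    (fun b hb => hsU (by simpa using hb))
  have h1 : s ⊆ {b | timesAfter (J b) = U ∧ t ∈ J b} :=
    fun b hb => ⟨hsU hb, ht b (by simpa using hb)⟩
  have h2 := (Set.encard_le_encard h1).trans (hd t)
  rw [hs] at h2
  have : d + 1 ≤ d := by exact_mod_cast h2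
  omega

/-- Two families of intervals have a matching in order of birth, if for each death and each time
the second family has at least as many intervals with that death that are alive at that time. -/
theorem exists_isInducedMatching {α β : Type*} {I : α → Set T} {J : β → Set T}
    (hI : ∀ a, (I a).Nonempty) (hI' : ∀ a, (I a).OrdConnected)
    (hJ : ∀ b, (J b).Nonempty) (hJ' : ∀ b, (J b).OrdConnected) (d : ℕ)
    (hd : ∀ t, {b | t ∈ J b}.encard ≤ d)
    (hcount : ∀ U t, IsUpperSet U → {a | timesAfter (I a) = U ∧ t ∈ I a}.encard ≤
      {b | timesAfter (J b) = U ∧ t ∈ J b}.encard) :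
    ∃ σ : α → β, IsInducedMatching I J σ := by
  have hBU : ∀ U, {b | timesAfter (J b) = U}.encard ≤ d := fun U =>
    encard_sameDeath_le hJ hJ' fun t =>
      (Set.encard_le_encard fun b hb => hb.2).trans (hd t)
  have hBfin : ∀ U, {b | timesAfter (J b) = U}.Finite := fun U => Set.finite_of_encard_le_coe (hBU U)
  have hAB : ∀ a₀, {a | timesAfter (I a) = timesAfter (I a₀)}.encard ≤
      {b | timesAfter (J b) = timesAfter (I a₀)}.encard := fun a₀ => by
    rw [← (hBfin _).cast_ncard_eq]
    -- The bound used here is the size of the class in the second family.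
    refine encard_sameDeath_le hI hI' fun t => ?_
    rw [(hBfin _).cast_ncard_eq]
    exact (hcount _ t (isUpperSet_timesAfter _)).trans (Set.encard_le_encard fun b hb => hb.1)
  have hAfin : ∀ a₀, {a | timesAfter (I a) = timesAfter (I a₀)}.Finite := fun a₀ =>
    Set.finite_of_encard_le_coe ((hAB a₀).trans (hBU _))
  have key : ∀ U : Set.range fun a => timesAfter (I a),
      ∃ σ : {a | timesAfter (I a) = U.1} → {b | timesAfter (J b) = U.1}, Function.Injective σ ∧
        (∀ a a', birthCut (I a.1) < birthCut (I a'.1) →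
          birthCut (J (σ a).1) ≤ birthCut (J (σ a').1)) ∧
        (∀ a b, birthCut (J b.1) < birthCut (J (σ a).1) → b ∈ Set.range σ) ∧
        ∀ a, birthCut (J (σ a).1) ≤ birthCut (I a.1) := by
    rintro ⟨_, a₀, rfl⟩
    dsimp only
    have := (hAfin a₀).to_subtype
    have := (hBfin (timesAfter (I a₀))).to_subtype
    obtain ⟨σ, h1, h2, h3, h4⟩ := exists_sorted_matching
      (fun a : {a | timesAfter (I a) = timesAfter (I a₀)} => birthCut (I a.1))
      (fun b : {b | timesAfter (J b) = timesAfter (I a₀)} => birthCut (J b.1))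
      (by
        have := hAB a₀
        rw [← (hBfin _).cast_ncard_eq, ← (hAfin _).cast_ncard_eq] at this
        rw [Nat.card_coe_set_eq, Nat.card_coe_set_eq]
        exact_mod_cast this)
    refine ⟨σ, h1, h2, h3, fun a => ?_⟩
    -- The intervals `J b` of the class that contain `t` form a lower set for birth, and `hcount`
    -- makes it large enough for the rank of `a`.
    have hall : ∀ t ∈ I a.1, t ∈ J (σ a).1 := fun t ht => by
      refine h4 a {b | t ∈ J b.1} ?_ ?_
      · intro b hb b' hb'
        exact mem_of_bornNoLater (hJ' _) (b.2.trans b'.2.symm) (birthCut_le_iff.1 hb') hb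
      · have h5 : {a' : {a | timesAfter (I a) = timesAfter (I a₀)} |
            birthCut (I a'.1) ≤ birthCut (I a.1)}.encard ≤
            {a' | timesAfter (I a') = timesAfter (I a₀) ∧ t ∈ I a'}.encard := by
          refine Set.encard_le_encard_of_injOn (f := Subtype.val) ?_ Subtype.val_injective.injOn
          intro a' ha'
          exact ⟨a'.2, mem_of_bornNoLater (hI' _) (a.2.trans a'.2.symm) (birthCut_le_iff.1 ha') ht⟩
        refine (h5.trans (hcount _ t (isUpperSet_timesAfter _))).trans ?_
        rw [← Subtype.val_injective.encard_image]
        refine Set.encard_le_encard ?_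
        rintro b ⟨hb, hb'⟩
        exact ⟨⟨b, hb⟩, hb', rfl⟩
    exact birthCut_le_iff.2 fun u hu s hs => hu s (hall s hs)
  choose τ hinj hmono hfirst hborn using key
  let D : α → Set.range fun a => timesAfter (I a) := fun a => ⟨timesAfter (I a), a, rfl⟩
  let σ : α → β := fun a => (τ (D a) ⟨a, rfl⟩).1
  have hσ : ∀ U (a : {a | timesAfter (I a) = U.1}), σ a.1 = (τ U a).1 := by
    rintro U ⟨a, ha⟩
    obtain rfl : U = D a := Subtype.ext ha.symm
    rfl
  have hdeath : ∀ a, timesAfter (J (σ a)) = timesAfter (I a) := fun a => (τ (D a) ⟨a, rfl⟩).2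
  refine ⟨σ, ?_, fun a => (hdeath a).symm, fun a => hborn (D a) ⟨a, rfl⟩, ?_, ?_⟩
  · intro a a' h
    have ha : timesAfter (I a') = timesAfter (I a) := by rw [← hdeath, ← h, hdeath]
    have := hinj (D a) (a₁ := ⟨a, rfl⟩) (a₂ := ⟨a', ha⟩)
      (Subtype.ext (by rw [← hσ, ← hσ]; exact h))
    exact congrArg Subtype.val this
  · intro a a' hd hb
    have := hmono (D a) ⟨a, rfl⟩ ⟨a', hd.symm⟩ (not_le.1 hb)
    rw [← hσ, ← hσ] at this
    exact this
  · intro a b hd hb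
    obtain ⟨a', ha'⟩ := hfirst (D a) ⟨a, rfl⟩ ⟨b, hd.trans (hdeath a)⟩ (not_le.1 hb)
    exact ⟨a'.1, by rw [hσ (D a) a', ha']⟩

end Births

/-! ### The bars of compatible bases -/

namespace PersistenceModule.CompatibleBases

section Bars

variable {R : Type v} [Ring R] {T : Type w} [LinearOrder T]
  {M : PersistenceModule.{u} R T} (𝓑 : M.CompatibleBases)

theorem map_mem_of_ne_zero {s t : T} (h : s ≤ t) {b : M.obj s} (hb : b ∈ 𝓑.B s)
    (h0 : M.map h b ≠ 0) : M.map h b ∈ 𝓑.B t :=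
  (𝓑.map_mem h b hb).resolve_right h0

/-- Two basis elements represent the same bar iff one is the image of the other. -/
def Linked (p q : Σ t, 𝓑.B t) : Prop :=
  (∃ h : p.1 ≤ q.1, M.map h p.2 = q.2) ∨ ∃ h : q.1 ≤ p.1, M.map h q.2 = p.2

theorem Linked.symm {p q : Σ t, 𝓑.B t} (h : 𝓑.Linked p q) : 𝓑.Linked q p := Or.symm h

/-- The bar of a basis element. -/
def barOf {t : T} (b : 𝓑.B t) : 𝓑.Bar := Quot.mk _ ⟨t, b⟩

theorem exists_barOf (β : 𝓑.Bar) : ∃ (t : T) (b : 𝓑.B t), 𝓑.barOf b = β := by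
  obtain ⟨⟨t, b⟩, rfl⟩ := Quot.exists_rep β
  exact ⟨t, b, rfl⟩

theorem mem_life_barOf {t : T} (b : 𝓑.B t) : t ∈ 𝓑.life (𝓑.barOf b) := ⟨b, rfl⟩

theorem life_nonempty (β : 𝓑.Bar) : (𝓑.life β).Nonempty := by
  obtain ⟨t, b, rfl⟩ := 𝓑.exists_barOf β
  exact ⟨t, 𝓑.mem_life_barOf b⟩

/-- The basis at time `t`. -/
noncomputable def basis (t : T) : Module.Basis (𝓑.B t) R (M.obj t) :=
  Module.Basis.mk (𝓑.linearIndependent t) (by rw [Subtype.range_coe, 𝓑.span_eq_top])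

theorem basis_apply (t : T) (b : 𝓑.B t) : 𝓑.basis t b = b := by
  simp [basis]

variable [Nontrivial R]

theorem ne_zero_of_mem {t : T} {b : M.obj t} (hb : b ∈ 𝓑.B t) : b ≠ 0 :=
  (𝓑.linearIndependent t).ne_zero (⟨b, hb⟩ : 𝓑.B t)

/-- The image of `p` at the time of `r` still maps to the basis element `q`, so it is nonzero, hence
a basis element, and `map_inj` identifies it with `r`. -/
theorem map_eq_of_common_image {p q r : Σ t, 𝓑.B t} (hpr : p.1 ≤ r.1) (hpq : p.1 ≤ q.1)
    (hrq : r.1 ≤ q.1) (hp : M.map hpq p.2 = q.2) (hr : M.map hrq r.2 = q.2) :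
    M.map hpr p.2 = r.2 := by
  have hcomp : M.map hrq (M.map hpr p.2.1) = q.2 := by rw [M.map_map, hp]
  have hmem : M.map hpr p.2.1 ∈ 𝓑.B r.1 := 𝓑.map_mem_of_ne_zero hpr p.2.2 fun h0 =>
    𝓑.ne_zero_of_mem q.2.2 (by rw [← hcomp, h0, map_zero])
  exact 𝓑.map_inj hrq _ hmem _ r.2.2 (hcomp ▸ q.2.2) (hcomp.trans hr.symm)

theorem Linked.trans {p q r : Σ t, 𝓑.B t} (h : 𝓑.Linked p q) (h' : 𝓑.Linked q r) :
    𝓑.Linked p r := by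
  rcases h with ⟨h, e⟩ | ⟨h, e⟩ <;> rcases h' with ⟨h', e'⟩ | ⟨h', e'⟩
  · exact Or.inl ⟨h.trans h', by rw [← M.map_map h h', e, e']⟩
  · rcases le_total p.1 r.1 with hpr | hpr
    · exact Or.inl ⟨hpr, 𝓑.map_eq_of_common_image hpr h h' e e'⟩
    · exact Or.inr ⟨hpr, 𝓑.map_eq_of_common_image hpr h' h e' e⟩
  · rcases le_total p.1 r.1 with hpr | hpr
    · exact Or.inl ⟨hpr, by rw [← e, M.map_map, e']⟩
    · exact Or.inr ⟨hpr, by rw [← e', M.map_map, e]⟩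
  · exact Or.inr ⟨h'.trans h, by rw [← M.map_map h' h, e', e]⟩

/-- `Linked` is already an equivalence relation, by totality of the order and injectivity on
surviving basis elements, so the quotient identifies nothing further. -/
theorem linked_of_barOf_eq {s t : T} {b : 𝓑.B s} {b' : 𝓑.B t} (h : 𝓑.barOf b = 𝓑.barOf b') :
    𝓑.Linked ⟨s, b⟩ ⟨t, b'⟩ := by
  have hgen := Quot.eqvGen_exact h
  generalize (⟨s, b⟩ : Σ t, 𝓑.B t) = p, (⟨t, b'⟩ : Σ t, 𝓑.B t) = q at hgen
  induction hgen with
  | rel p q h => exact Or.inl h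
  | refl p => exact Or.inl ⟨le_rfl, M.map_self _ _⟩
  | symm p q _ ih => exact ih.symm
  | trans p q r _ _ ih ih' => exact ih.trans 𝓑 ih'

theorem barOf_eq_iff {s t : T} (h : s ≤ t) {b : 𝓑.B s} {b' : 𝓑.B t} :
    𝓑.barOf b = 𝓑.barOf b' ↔ M.map h b.1 = b'.1 := by
  refine ⟨fun e => ?_, fun e => Quot.sound ⟨h, e⟩⟩
  rcases 𝓑.linked_of_barOf_eq e with ⟨_, e⟩ | ⟨h', e⟩
  · exact e
  · obtain rfl : s = t := le_antisymm h h'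
    rw [M.map_self] at e ⊢
    exact e.symm

theorem barOf_injective (t : T) : Function.Injective (𝓑.barOf (t := t)) := fun b b' h =>
  Subtype.ext (by rw [← (𝓑.barOf_eq_iff le_rfl).1 h, M.map_self])

theorem mem_life_barOf_iff {s t : T} (h : s ≤ t) (b : 𝓑.B s) :
    t ∈ 𝓑.life (𝓑.barOf b) ↔ M.map h b.1 ≠ 0 := by
  constructor
  · rintro ⟨b', hb'⟩
    rw [(𝓑.barOf_eq_iff h).1 hb'.symm]
    exact 𝓑.ne_zero_of_mem b'.2
  · intro h0
    exact ⟨⟨_, 𝓑.map_mem_of_ne_zero h b.2 h0⟩, ((𝓑.barOf_eq_iff h).2 rfl).symm⟩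

theorem ordConnected_life (β : 𝓑.Bar) : (𝓑.life β).OrdConnected := by
  refine ⟨fun s hs u hu t ht => ?_⟩
  obtain ⟨b, rfl⟩ := hs
  have hu' := (𝓑.mem_life_barOf_iff (ht.1.trans ht.2) b).1 hu
  refine (𝓑.mem_life_barOf_iff ht.1 b).2 fun h0 => hu' ?_
  rw [← M.map_map ht.1 ht.2, h0, map_zero]

/-- A time `t ≥ s` is not before the birth, so by order-convexity it is either in the life or after
it. -/
theorem mem_timesAfter_barOf_iff {s t : T} (h : s ≤ t) (b : 𝓑.B s) :
    t ∈ timesAfter (𝓑.life (𝓑.barOf b)) ↔ M.map h b.1 = 0 := by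
  rw [← not_iff_not, ← ne_eq, ← 𝓑.mem_life_barOf_iff h b]
  refine ⟨fun ht => ?_, notMem_timesAfter⟩
  refine mem_of_notMem_timesBefore_of_notMem_timesAfter (𝓑.ordConnected_life _) (fun hb => ?_) ht
  exact absurd h (hb s (𝓑.mem_life_barOf b)).not_ge

/-- The basis elements at time `t` whose bars die at the upper set `U`. -/
def dyingAt (t : T) (U : Set T) : Set (𝓑.B t) :=
  {b | ∀ (u : T) (h : t ≤ u), M.map h b.1 = 0 ↔ u ∈ U}

theorem timesAfter_barOf_eq_iff {t : T} (b : 𝓑.B t) {U : Set T} (hU : IsUpperSet U) :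
    timesAfter (𝓑.life (𝓑.barOf b)) = U ↔ b ∈ 𝓑.dyingAt t U := by
  constructor
  · rintro rfl u h
    exact (𝓑.mem_timesAfter_barOf_iff h b).symm
  · intro hb
    ext u
    rcases le_total t u with h | h
    · rw [𝓑.mem_timesAfter_barOf_iff h b, hb u h]
    -- Times up to `t` are in neither set: if `u ∈ U`, then `t ∈ U` and `b` itself would be zero.
    · refine iff_of_false (fun hu => ?_) (fun hu => ?_)
      · exact absurd h (hu t (𝓑.mem_life_barOf b)).not_ge
      · exact 𝓑.ne_zero_of_mem b.2 (by rw [← (hb t le_rfl).2 (hU h hu), M.map_self])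

theorem setOf_bars_eq_image (t : T) {U : Set T} (hU : IsUpperSet U) :
    {β | timesAfter (𝓑.life β) = U ∧ t ∈ 𝓑.life β} = 𝓑.barOf '' 𝓑.dyingAt t U := by
  ext β
  constructor
  · rintro ⟨hβ, b, rfl⟩
    exact ⟨b, (𝓑.timesAfter_barOf_eq_iff b hU).1 hβ, rfl⟩
  · rintro ⟨b, hb, rfl⟩
    exact ⟨(𝓑.timesAfter_barOf_eq_iff b hU).2 hb, 𝓑.mem_life_barOf b⟩

theorem encard_bars_eq (t : T) {U : Set T} (hU : IsUpperSet U) :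
    {β | timesAfter (𝓑.life β) = U ∧ t ∈ 𝓑.life β}.encard = (𝓑.dyingAt t U).encard := by
  rw [𝓑.setOf_bars_eq_image t hU, (𝓑.barOf_injective t).encard_image]

theorem encard_alive_eq (t : T) : {β | t ∈ 𝓑.life β}.encard = (𝓑.B t).encard := by
  have : {β | t ∈ 𝓑.life β} = Set.range (𝓑.barOf (t := t)) := rfl
  rw [this, ← Set.image_univ, (𝓑.barOf_injective t).encard_image, Set.encard_univ]
  rfl

end Bars

end PersistenceModule.CompatibleBases

/-! ### The matching induced by a monomorphism -/

namespace PersistenceModule.CompatibleBases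

variable {R : Type v} {T : Type w} [LinearOrder T]

/-! ### Structure maps in coordinates -/

section Coordinates

variable [Ring R] {M : PersistenceModule.{u} R T} (𝓑 : M.CompatibleBases)

theorem map_eq_zero_of_mem_span {t u : T} (h : t ≤ u) {s : Set (𝓑.B t)}
    (hs : ∀ b ∈ s, M.map h b.1 = 0) {x : M.obj t} (hx : x ∈ Submodule.span R (𝓑.basis t '' s)) :
    M.map h x = 0 := by
  refine (Submodule.span_le.2 ?_ : _ ≤ LinearMap.ker (M.map h)) hx
  rintro _ ⟨b, hb, rfl⟩
  simpa [basis_apply] using hs b hb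

/-- Finitely many vectors that are killed outside the upper set `U` are killed at a common time
outside `U`. -/
theorem exists_common_map_eq_zero {t : T} {U : Set T} (ht : t ∉ U) (s : Finset (𝓑.B t))
    (hs : ∀ b ∈ s, ∃ (u : T) (h : t ≤ u), u ∉ U ∧ M.map h b.1 = 0) :
    ∃ (u : T) (h : t ≤ u), u ∉ U ∧ ∀ b ∈ s, M.map h b.1 = 0 := by
  classical
  induction s using Finset.induction_on with
  -- With nothing to kill, `t` itself serves; this is what `t ∉ U` is for.
  | empty => exact ⟨t, le_rfl, ht, by simp⟩
  | insert a s _ ih =>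
    obtain ⟨u, hu, huU, h0⟩ := ih fun b hb => hs b (Finset.mem_insert_of_mem hb)
    obtain ⟨u', hu', huU', h0'⟩ := hs a (Finset.mem_insert_self a s)
    rcases le_total u u' with h | h
    · refine ⟨u', hu', huU', fun b hb => ?_⟩
      rcases Finset.mem_insert.1 hb with rfl | hb
      · exact h0'
      · rw [← M.map_map hu h, h0 b hb, map_zero]
    · refine ⟨u, hu, huU, fun b hb => ?_⟩
      rcases Finset.mem_insert.1 hb with rfl | hb
      · rw [← M.map_map hu' h, h0', map_zero]
      · exact h0 b hb

variable [Nontrivial R]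

/-- The structure maps preserve the coordinates at the basis elements that survive. -/
theorem repr_map_apply {s t : T} (h : s ≤ t) (b : 𝓑.B s) (hb : M.map h b.1 ∈ 𝓑.B t)
    (x : M.obj s) : (𝓑.basis t).repr (M.map h x) ⟨_, hb⟩ = (𝓑.basis s).repr x b := by
  have : (Finsupp.lapply ⟨M.map h b.1, hb⟩ ∘ₗ (𝓑.basis t).repr.toLinearMap ∘ₗ M.map h) =
      Finsupp.lapply b ∘ₗ (𝓑.basis s).repr.toLinearMap := by
    refine (𝓑.basis s).ext fun b' => ?_
    simp only [LinearMap.comp_apply, LinearEquiv.coe_coe, Finsupp.lapply_apply,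
      Module.Basis.repr_self]
    rw [basis_apply]
    -- By `map_inj` no basis element other than `b` reaches the image of `b`, so nothing else
    -- contributes to that coordinate.
    rcases 𝓑.map_mem h b'.1 b'.2 with hb' | hb'
    · have e : M.map h b'.1 = 𝓑.basis t ⟨_, hb'⟩ :=
        (𝓑.basis_apply t ⟨_, hb'⟩).symm
      rw [e, Module.Basis.repr_self]
      by_cases hbb : b' = b
      · subst hbb; simp
      · rw [Finsupp.single_eq_of_ne' hbb, Finsupp.single_eq_of_ne']
        intro he
        exact hbb (Subtype.ext (𝓑.map_inj h _ b'.2 _ b.2 hb' (congrArg Subtype.val he)))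
    · rw [hb', map_zero, Finsupp.zero_apply, Finsupp.single_eq_of_ne']
      rintro rfl
      exact 𝓑.ne_zero_of_mem hb hb'
  exact DFunLike.congr_fun this x

/-- A vector is killed by a structure map only if the basis elements in its support are. -/
theorem repr_eq_zero_of_map_eq_zero {s t : T} (h : s ≤ t) (b : 𝓑.B s) (hb : M.map h b.1 ≠ 0)
    {x : M.obj s} (hx : M.map h x = 0) : (𝓑.basis s).repr x b = 0 := by
  rw [← 𝓑.repr_map_apply h b (𝓑.map_mem_of_ne_zero h b.2 hb), hx, map_zero, Finsupp.zero_apply]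

/-- A vector in the span of basis elements dying at `U` is not killed outside `U`. -/
theorem eq_zero_of_mem_span_dyingAt {t u : T} (h : t ≤ u) {U : Set T} (hu : u ∉ U) {x : M.obj t}
    (hx : x ∈ Submodule.span R (𝓑.basis t '' 𝓑.dyingAt t U)) (hx0 : M.map h x = 0) : x = 0 := by
  rw [Module.Basis.mem_span_image] at hx
  refine (𝓑.basis t).repr.map_eq_zero_iff.1 (Finsupp.ext fun b => ?_)
  by_contra hb
  exact hb (𝓑.repr_eq_zero_of_map_eq_zero h b
    (fun h0 => hu ((hx (Finsupp.mem_support_iff.2 hb) u h).1 h0)) hx0)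

/-- A vector that is killed at all times in `U` and has no coordinate at a basis element dying at
`U` is killed at a time outside `U`. -/
theorem exists_map_eq_zero_of_repr_eq_zero {t : T} {U : Set T} (ht : t ∉ U) {y : M.obj t}
    (hy : ∀ (u : T) (h : t ≤ u), u ∈ U → M.map h y = 0)
    (hy' : ∀ b ∈ 𝓑.dyingAt t U, (𝓑.basis t).repr y b = 0) :
    ∃ (u : T) (h : t ≤ u), u ∉ U ∧ M.map h y = 0 := by
  obtain ⟨u, h, huU, h0⟩ := 𝓑.exists_common_map_eq_zero ht ((𝓑.basis t).repr y).support
    (fun b hb => by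
      rw [Finsupp.mem_support_iff] at hb
      by_contra! hne
      refine hb (hy' b fun u h => ⟨fun h0 => ?_, fun huU => ?_⟩)
      · by_contra huU
        exact hne u h huU h0
      · by_contra h0
        exact hb (𝓑.repr_eq_zero_of_map_eq_zero h b h0 (hy u h huU)))
  exact ⟨u, h, huU, 𝓑.map_eq_zero_of_mem_span h (s := ((𝓑.basis t).repr y).support)
    (fun b hb => h0 b hb) ((𝓑.basis t).mem_span_image.2 subset_rfl)⟩

end Coordinates

section Monomorphism

variable [DivisionRing R] {M N : PersistenceModule.{u} R T} (𝓑 : M.CompatibleBases)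
  (𝓒 : N.CompatibleBases)

/-- A monomorphism does not decrease the number of basis elements with a given death. -/
theorem encard_dyingAt_le (f : M.Hom N) (hf : ∀ t, Function.Injective (f.app t)) (t : T)
    [Module.Finite R (N.obj t)] (U : Set T) :
    (𝓑.dyingAt t U).encard ≤ (𝓒.dyingAt t U).encard := by
  by_cases ht : t ∈ U
  · have : 𝓑.dyingAt t U = ∅ := Set.eq_empty_of_forall_notMem fun b hb =>
      𝓑.ne_zero_of_mem b.2 (by rw [← (hb t le_rfl).2 ht, M.map_self])
    simp [this]
  have : Finite (𝓒.B t) := Module.Finite.finite_basis (𝓒.basis t)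
  let π : N.obj t →ₗ[R] (𝓒.dyingAt t U →₀ R) :=
    Finsupp.lsubtypeDomain (𝓒.dyingAt t U) ∘ₗ (𝓒.basis t).repr.toLinearMap
  have hli : LinearIndependent R fun b : 𝓑.dyingAt t U => 𝓑.basis t b :=
    (𝓑.basis t).linearIndependent.comp _ Subtype.val_injective
  have hli' := hli.map (f := π ∘ₗ f.app t) (by
    rw [Submodule.disjoint_def]
    intro x hx hx0
    have hrange : (Set.range fun b : 𝓑.dyingAt t U => 𝓑.basis t b) =
        𝓑.basis t '' 𝓑.dyingAt t U := by
      rw [Set.image_eq_range]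
    rw [hrange] at hx
    obtain ⟨u, h, huU, h0⟩ := 𝓒.exists_map_eq_zero_of_repr_eq_zero ht (y := f.app t x)
      (fun u h huU => by
        rw [← f.naturality h, 𝓑.map_eq_zero_of_mem_span h (fun b hb => (hb u h).2 huU) hx,
          map_zero])
      (fun b hb => DFunLike.congr_fun (LinearMap.mem_ker.1 hx0) ⟨b, hb⟩)
    rw [← f.naturality h] at h0
    exact 𝓑.eq_zero_of_mem_span_dyingAt h huU hx (hf u (by rw [h0, map_zero])))
  have : Finite (𝓑.dyingAt t U) := hli'.finite
  have := Fintype.ofFinite (𝓑.dyingAt t U)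
  have hle := hli'.fintype_card_le_finrank
  rw [Module.finrank_eq_nat_card_basis (Finsupp.basisSingleOne (R := R)),
    ← Nat.card_eq_fintype_card, Nat.card_coe_set_eq, Nat.card_coe_set_eq] at hle
  rw [← (Set.toFinite (𝓑.dyingAt t U)).cast_ncard_eq, ← (Set.toFinite (𝓒.dyingAt t U)).cast_ncard_eq]
  exact_mod_cast hle

/-- A monomorphism into a persistence module with bounded dimensions induces a matching. -/
theorem exists_isInducedMatching_life (f : M.Hom N) (hf : ∀ t, Function.Injective (f.app t)) (d : ℕ)
    [∀ t, Module.Finite R (N.obj t)] (hd : ∀ t, Module.finrank R (N.obj t) ≤ d) :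
    ∃ σ : 𝓑.Bar → 𝓒.Bar, IsInducedMatching 𝓑.life 𝓒.life σ := by
  refine exists_isInducedMatching 𝓑.life_nonempty 𝓑.ordConnected_life 𝓒.life_nonempty
    𝓒.ordConnected_life d (fun t => ?_) (fun U t hU => ?_)
  · rw [𝓒.encard_alive_eq]
    have : Finite (𝓒.B t) := Module.Finite.finite_basis (𝓒.basis t)
    have h := hd t
    rw [Module.finrank_eq_nat_card_basis (𝓒.basis t), Nat.card_coe_set_eq] at h
    rw [← (Set.toFinite (𝓒.B t)).cast_ncard_eq]
    exact_mod_cast h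
  · rw [𝓑.encard_bars_eq t hU, 𝓒.encard_bars_eq t hU]
    exact 𝓑.encard_dyingAt_le 𝓒 f hf t U

end Monomorphism

end PersistenceModule.CompatibleBases

/-! ### Existence of compatible bases -/

namespace PersistenceModule

section Constructions

variable {R : Type v} [Ring R] {T : Type w} [Preorder T]

/-- The persistence submodule given by a family of submodules that the structure maps preserve. -/
def restrict (M : PersistenceModule.{u} R T) (C : ∀ t, Submodule R (M.obj t))
    (hC : ∀ {s t : T} (h : s ≤ t), ∀ x ∈ C s, M.map h x ∈ C t) : PersistenceModule.{u} R T where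
  obj t := C t
  map h := (M.map h).restrict (hC h)
  map_self t x := Subtype.ext (M.map_self t x.1)
  map_map h h' x := Subtype.ext (M.map_map h h' x.1)

/-- The pullback of a persistence module along a monotone map. -/
def reindex {P : Type*} [Preorder P] (M : PersistenceModule.{u} R T) {r : P → T} (hr : Monotone r) :
    PersistenceModule.{u} R P where
  obj p := M.obj (r p)
  map h := M.map (hr h)
  map_self p x := M.map_self (r p) x
  map_map h h' x := M.map_map (hr h) (hr h') x

/-- Compatible bases transfer along levelwise isomorphisms over a monotone map. -/
def CompatibleBases.comap {P : Type*} [Preorder P] {M : PersistenceModule.{u} R T}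
    {N : PersistenceModule.{u} R P} (𝓑 : N.CompatibleBases) {q : T → P} (hq : Monotone q)
    (e : ∀ t, M.obj t ≃ₗ[R] N.obj (q t))
    (he : ∀ {s t : T} (h : s ≤ t) (x : M.obj s), e t (M.map h x) = N.map (hq h) (e s x)) :
    M.CompatibleBases where
  B t := e t ⁻¹' 𝓑.B (q t)
  linearIndependent t := by
    have h := (𝓑.linearIndependent (q t)).comp
      (fun x : e t ⁻¹' 𝓑.B (q t) => (⟨e t x.1, x.2⟩ : 𝓑.B (q t)))
      (fun x y h => Subtype.ext ((e t).injective (congrArg Subtype.val h)))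
    exact LinearIndependent.of_comp (e t).toLinearMap h
  span_eq_top t := by
    have h : (e t ⁻¹' 𝓑.B (q t)) = (e t).symm '' 𝓑.B (q t) := by
      rw [LinearEquiv.image_symm_eq_preimage]
    rw [h]
    have := Submodule.map_span (e t).symm.toLinearMap (𝓑.B (q t))
    rw [𝓑.span_eq_top, Submodule.map_top, LinearEquiv.range] at this
    exact this.symm
  map_mem h b hb := by
    rw [Set.mem_preimage, he h]
    refine (𝓑.map_mem (hq h) _ hb).imp_right fun h0 => ?_
    rw [← he h] at h0
    exact (e _).map_eq_zero_iff.1 h0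
  map_inj h b hb b' hb' hmem heq := by
    refine (e _).injective (𝓑.map_inj (hq h) _ hb _ hb' ?_ ?_)
    · rw [← he h]; exact hmem
    · rw [← he h, ← he h, heq]

end Constructions

section Splitting

variable {R : Type v} [DivisionRing R] {T : Type w} [LinearOrder T]

/-- The vectors at each time on which the linear form `φ` at time `j` vanishes later. -/
def kernelAt (M : PersistenceModule.{u} R T) {j : T} (φ : M.obj j →ₗ[R] R) (t : T) :
    Submodule R (M.obj t) :=
  ⨅ h : t ≤ j, LinearMap.ker (φ ∘ₗ M.map h)

theorem mem_kernelAt {M : PersistenceModule.{u} R T} {j : T} {φ : M.obj j →ₗ[R] R} {t : T}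
    {x : M.obj t} : x ∈ M.kernelAt φ t ↔ ∀ h : t ≤ j, φ (M.map h x) = 0 := by
  simp [kernelAt]

theorem map_mem_kernelAt {M : PersistenceModule.{u} R T} {j : T} {φ : M.obj j →ₗ[R] R} {s t : T}
    (h : s ≤ t) (x : M.obj s) (hx : x ∈ M.kernelAt φ s) : M.map h x ∈ M.kernelAt φ t :=
  mem_kernelAt.2 fun h' => by rw [M.map_map]; exact mem_kernelAt.1 hx _

/-- Compatible bases of the kernel of a form that does not vanish on a vector `x` which is present
from the first nonzero time on extend, by the images of `x`, to the whole module. -/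
theorem nonempty_compatibleBases_of_kernelAt {M : PersistenceModule.{u} R T} {i j : T} (hij : i ≤ j)
    (hi : ∀ t < i, Subsingleton (M.obj t)) {x : M.obj i} (hj : ∀ t (h : i ≤ t), j < t → M.map h x = 0)
    {φ : M.obj j →ₗ[R] R} (hφ : φ (M.map hij x) = 1)
    (𝓒 : (M.restrict (M.kernelAt φ) map_mem_kernelAt).CompatibleBases) :
    Nonempty M.CompatibleBases := by
  let C (t : T) : Set (M.obj t) := Subtype.val '' (show Set (M.kernelAt φ t) from 𝓒.B t)
  let I (t : T) : Set (M.obj t) := {y | ∃ h : i ≤ t, t ≤ j ∧ M.map h x = y}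
  have hCspan : ∀ t, Submodule.span R (C t) = M.kernelAt φ t := fun t => by
    have := Submodule.map_span (M.kernelAt φ t).subtype (𝓒.B t)
    have h2 : Submodule.span R (show Set (M.kernelAt φ t) from 𝓒.B t) = ⊤ := 𝓒.span_eq_top t
    erw [h2] at this
    rw [Submodule.map_top, Submodule.range_subtype] at this
    exact this.symm
  have hCker : ∀ t, ∀ y ∈ C t, y ∈ M.kernelAt φ t := fun t y hy => by
    obtain ⟨c, -, rfl⟩ := hy
    exact c.2
  have hCli : ∀ t, LinearIndepOn R id (C t) := fun t => by
    have := (𝓒.linearIndependent t).map' (M.kernelAt φ t).subtype (Submodule.ker_subtype _)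
    exact LinearIndepOn.id_image (s := 𝓒.B t) (v := Subtype.val) this
  have hI : ∀ t, ∀ y ∈ I t, y ∉ M.kernelAt φ t := by
    rintro t y ⟨h, htj, rfl⟩ hy
    have := mem_kernelAt.1 hy htj
    rw [M.map_map, hφ] at this
    exact one_ne_zero this
  have hli : ∀ t, LinearIndepOn R id (I t ∪ C t) := fun t => by
    by_cases ht : i ≤ t ∧ t ≤ j
    · have : I t ∪ C t = insert (M.map ht.1 x) (C t) := by
        rw [Set.insert_eq]
        congr 1
        ext y
        exact ⟨fun ⟨_, _, h⟩ => h.symm, fun h => ⟨ht.1, ht.2, (Set.mem_singleton_iff.1 h).symm⟩⟩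
      rw [this]
      refine (hCli t).id_insert ?_
      rw [hCspan]
      exact hI t _ ⟨ht.1, ht.2, rfl⟩
    · have : I t = ∅ := Set.eq_empty_of_forall_notMem fun y ⟨h, h', _⟩ => ht ⟨h, h'⟩
      rw [this, Set.empty_union]
      exact hCli t
  have hspan : ∀ t, Submodule.span R (I t ∪ C t) = ⊤ := fun t => by
    rw [eq_top_iff]
    rintro y -
    rw [Submodule.span_union, hCspan]
    by_cases htj : t ≤ j
    · by_cases hit : i ≤ t
      · refine Submodule.mem_sup.2 ⟨φ (M.map htj y) • M.map hit x,
          Submodule.smul_mem _ _ (Submodule.subset_span ⟨hit, htj, rfl⟩),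
          y - φ (M.map htj y) • M.map hit x, mem_kernelAt.2 fun _ => ?_, by abel⟩
        rw [map_sub, map_sub, map_smul, map_smul, M.map_map, hφ, smul_eq_mul, mul_one, sub_self]
      · have := hi t (not_le.1 hit)
        rw [Subsingleton.elim y 0]
        exact zero_mem _
    · exact Submodule.mem_sup_right (mem_kernelAt.2 fun h => absurd h htj)
  have hne : ∀ t, (0 : M.obj t) ∉ I t ∪ C t := fun t h0 => (hli t).ne_zero h0 rfl
  have hcross : ∀ {s t : T} (h : s ≤ t), ∀ c ∈ C s, ∀ y ∈ I s, M.map h y ∈ I t ∪ C t →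
      M.map h c ≠ M.map h y := by
    rintro s t h c hc _ ⟨his, hsj, rfl⟩ hmem heq
    rw [M.map_map] at heq hmem
    by_cases htj : t ≤ j
    · refine hI t _ ⟨his.trans h, htj, rfl⟩ ?_
      rw [← heq]
      exact map_mem_kernelAt h c (hCker s c hc)
    · rw [hj t (his.trans h) (not_le.1 htj)] at hmem
      exact hne t hmem
  refine ⟨⟨fun t => I t ∪ C t, fun t => hli t, hspan, ?_, ?_⟩⟩
  · rintro s t h b (⟨his, hsj, rfl⟩ | ⟨c, hc, rfl⟩)
    · rw [M.map_map]
      by_cases htj : t ≤ j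
      · exact Or.inl (Or.inl ⟨his.trans h, htj, rfl⟩)
      · exact Or.inr (hj t (his.trans h) (not_le.1 htj))
    · rcases 𝓒.map_mem h c hc with h' | h'
      · exact Or.inl (Or.inr ⟨_, h', rfl⟩)
      · exact Or.inr (congrArg Subtype.val h')
  · rintro s t h b hb b' hb' hmem heq
    rcases hb with hb | hb <;> rcases hb' with hb' | hb'
    · obtain ⟨_, _, rfl⟩ := hb
      obtain ⟨_, _, rfl⟩ := hb'
      rfl
    · exact absurd heq.symm (hcross h b' hb' b hb hmem)
    · exact absurd heq (hcross h b hb b' hb' (heq ▸ hmem))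
    · rcases hmem with hmem | hmem
      · exact absurd (map_mem_kernelAt h b (hCker s b hb)) (hI t _ hmem)
      · obtain ⟨c, hc, rfl⟩ := hb
        obtain ⟨c', hc', rfl⟩ := hb'
        obtain ⟨d, hd, hd'⟩ := hmem
        have hdc : (M.restrict (M.kernelAt φ) map_mem_kernelAt).map h c = d := Subtype.ext hd'.symm
        exact congrArg Subtype.val
          (𝓒.map_inj h c hc c' hc' (hdc ▸ hd) (Subtype.ext heq))

/-- Pointwise finite-dimensional persistence modules over a finite linear order have compatible
bases. -/
theorem nonempty_compatibleBases_of_finite [Finite T] (M : PersistenceModule.{u} R T)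
    [∀ t, Module.Finite R (M.obj t)] : Nonempty M.CompatibleBases := by
  have := Fintype.ofFinite T
  induction hk : ∑ t, Module.finrank R (M.obj t) using Nat.strong_induction_on generalizing M with
  | _ k ih =>
  subst hk
  by_cases hM : ∃ t, Nontrivial (M.obj t)
  · obtain ⟨i, hi, hmin⟩ := WellFounded.has_min (wellFounded_lt (α := T))
      {t | Nontrivial (M.obj t)} hM
    have hi : Nontrivial (M.obj i) := hi
    have hmin : ∀ t < i, Subsingleton (M.obj t) := fun t ht =>
      not_nontrivial_iff_subsingleton.1 fun h => hmin t h ht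
    obtain ⟨x, hx⟩ := exists_ne (0 : M.obj i)
    obtain ⟨j, ⟨hij, hxj⟩, hmax⟩ := WellFounded.has_min (wellFounded_gt (α := T))
      {t | ∃ h : i ≤ t, M.map h x ≠ 0} ⟨i, le_rfl, by rwa [M.map_self]⟩
    obtain ⟨φ, hφ⟩ := LinearMap.exists_leftInverse_of_injective
      (LinearMap.toSpanSingleton R (M.obj j) (M.map hij x))
      (LinearMap.ker_toSpanSingleton R hxj)
    have hφ : φ (M.map hij x) = 1 := by simpa using DFunLike.congr_fun hφ 1
    have hxC : x ∉ M.kernelAt φ i := fun h => one_ne_zero (hφ ▸ mem_kernelAt.1 h hij)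
    have hfin : ∀ t, Module.Finite R ((M.restrict (M.kernelAt φ) map_mem_kernelAt).obj t) :=
      fun t => inferInstanceAs (Module.Finite R (M.kernelAt φ t))
    obtain ⟨𝓒⟩ := ih _ (Finset.sum_lt_sum (fun t _ => Submodule.finrank_le (M.kernelAt φ t))
      ⟨i, Finset.mem_univ i, Submodule.finrank_lt fun h => hxC (h ▸ Submodule.mem_top)⟩)
      (M.restrict (M.kernelAt φ) map_mem_kernelAt) rfl
    refine nonempty_compatibleBases_of_kernelAt hij hmin (fun t h hjt => ?_) hφ 𝓒
    by_contra h0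
    exact hmax t ⟨h, h0⟩ hjt
  · have hM : ∀ t, Subsingleton (M.obj t) := fun t =>
      not_nontrivial_iff_subsingleton.1 fun h => hM ⟨t, h⟩
    exact ⟨⟨fun _ => ∅, fun t => linearIndependent_empty_type, fun t => Subsingleton.elim _ _,
      fun _ _ h => h.elim, fun _ _ h => h.elim⟩⟩

/-- A pointwise finite-dimensional persistence module whose structure maps are isomorphisms except
at finitely many steps has compatible bases. -/
theorem nonempty_compatibleBases_of_tame (M : PersistenceModule.{u} R T)
    [∀ t, Module.Finite R (M.obj t)] {q : T → ℕ} (hq : Monotone q) {m : ℕ} (hm : ∀ t, q t ≤ m)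
    (hiso : ∀ {s t : T} (h : s ≤ t), q s = q t → Function.Bijective (M.map h)) :
    Nonempty M.CompatibleBases := by
  have : Finite (Set.range q) := (Set.finite_Iic m).subset (by rintro _ ⟨t, rfl⟩; exact hm t)
  choose r hr using fun p : Set.range q => p.2
  have hrmono : Monotone r := fun p p' hpp => by
    by_contra hlt
    have h := hq (le_of_not_ge hlt)
    rw [hr, hr] at h
    obtain rfl : p = p' := le_antisymm hpp h
    exact hlt le_rfl
  let q' : T → Set.range q := fun t => ⟨q t, t, rfl⟩
  have hq' : Monotone q' := fun s t h => hq h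
  let top (t : T) : T := max t (r (q' t))
  have hqr : ∀ t, q (r (q' t)) = q t := fun t => hr (q' t)
  have hqtop : ∀ t, q (top t) = q t := fun t => by
    rcases max_choice t (r (q' t)) with h | h
    · exact congrArg q h
    · exact (congrArg q h).trans (hqr t)
  have htop : Monotone top := fun s t h => max_le_max h (hrmono (hq' h))
  let e₁ (t : T) : M.obj t ≃ₗ[R] M.obj (top t) :=
    LinearEquiv.ofBijective (M.map (le_max_left _ _)) (hiso _ (hqtop t).symm)
  let e₂ (t : T) : M.obj (r (q' t)) ≃ₗ[R] M.obj (top t) :=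
    LinearEquiv.ofBijective (M.map (le_max_right _ _)) (hiso _ ((hqr t).trans (hqtop t).symm))
  have hfin : ∀ p, Module.Finite R ((M.reindex hrmono).obj p) :=
    fun p => inferInstanceAs (Module.Finite R (M.obj (r p)))
  obtain ⟨𝓑⟩ := (M.reindex hrmono).nonempty_compatibleBases_of_finite
  refine ⟨𝓑.comap hq' (fun t => (e₁ t).trans (e₂ t).symm) fun {s t} h x => ?_⟩
  have key : ∀ y : M.obj (r (q' s)), e₂ t (M.map (hrmono (hq' h)) y) = M.map (htop h) (e₂ s y) :=
    fun y => by
      simp only [e₂, LinearEquiv.ofBijective_apply, M.map_map]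
  have key' : e₁ t (M.map h x) = M.map (htop h) (e₁ s x) := by
    simp only [e₁, LinearEquiv.ofBijective_apply, M.map_map]
  apply (e₂ t).injective
  refine Eq.trans ?_ (key ((e₂ s).symm (e₁ s x))).symm
  rw [LinearEquiv.apply_symm_apply, ← key']
  exact (e₂ t).apply_symm_apply _

end Splitting

end PersistenceModule

/-! ### Homology of subcomplexes -/

namespace DirectedComplex

variable {V : Type u} {X Y : DirectedComplex V} {n : ℕ}

section Semiring

variable {R : Type v} [Semiring R]

theorem chainMap_injective (h : X ≤ Y) (n : ℕ) : Function.Injective (chainMap R h n) :=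
  Finsupp.mapDomain_injective (Set.inclusion_injective (h n))

theorem chainMap_surjective (h : X ≤ Y) (hs : Y.simplices n ⊆ X.simplices n) :
    Function.Surjective (chainMap R h n) :=
  Finsupp.mapDomain_surjective fun σ => ⟨⟨σ.1, hs σ.2⟩, rfl⟩

theorem mem_cycles_of_chainMap_mem (h : X ≤ Y) : ∀ {n : ℕ} {x : X.Chain R n},
    chainMap R h n x ∈ Y.cycles R n → x ∈ X.cycles R n
  | 0, _, _ => Submodule.mem_top
  | n + 1, x, hx => by
    change X.boundaryPos R n x = X.boundaryNeg R n x
    apply chainMap_injective h n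
    rw [chainMap_boundaryPos, chainMap_boundaryNeg]
    exact hx

theorem homologyMap_surjective (h : X ≤ Y) (hs : Y.simplices n ⊆ X.simplices n) :
    Function.Surjective (homologyMap R h n) := by
  intro y
  obtain ⟨⟨y, hy⟩, rfl⟩ := homologyClass_surjective n y
  obtain ⟨x, rfl⟩ := chainMap_surjective h hs y
  exact ⟨X.homologyClass R n ⟨x, mem_cycles_of_chainMap_mem h hy⟩, rfl⟩

theorem homologyMap_injective (h : X ≤ Y) (hs : Y.simplices (n + 1) ⊆ X.simplices (n + 1)) :
    Function.Injective (homologyMap R h n) := by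
  intro x y hxy
  obtain ⟨x, rfl⟩ := homologyClass_surjective n x
  obtain ⟨y, rfl⟩ := homologyClass_surjective n y
  rw [homologyMap_class, homologyMap_class, homologyClass_eq_iff] at hxy
  obtain ⟨a, b, hab⟩ := hxy
  obtain ⟨a, rfl⟩ := chainMap_surjective h hs a
  obtain ⟨b, rfl⟩ := chainMap_surjective h hs b
  refine homologyClass_eq_iff.2 ⟨a, b, chainMap_injective h n ?_⟩
  simp only [map_add, chainMap_boundaryPos, chainMap_boundaryNeg]
  exact hab

end Semiring

/-- If two nested complexes have the same `n`-simplices, the directed homology of the larger one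
comes from the smaller one. -/
theorem exists_directed_of_subset {Λ : Type v} [Semiring Λ] (h : X ≤ Y)
    (hs : Y.simplices n ⊆ X.simplices n) {y : Y.Homology (RingCompletion Λ) n}
    (hy : y ∈ Y.directedHomology Λ n) :
    ∃ x ∈ X.directedHomology Λ n, homologyMap (RingCompletion Λ) h n x = y := by
  have : Y.directedHomology Λ n ≤
      (X.directedHomology Λ n).map (homologyMap (RingCompletion Λ) h n) := by
    refine Submodule.span_le.2 ?_
    rintro _ ⟨y, rfl⟩
    obtain ⟨x, rfl⟩ := homologyMap_surjective h hs y
    exact ⟨_, Submodule.subset_span ⟨x, rfl⟩, homologyMap_completionHomology h n x⟩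
  exact this hy

section Dimension

variable [Finite V]

instance finite_homology {R : Type v} [Ring R] [IsNoetherianRing R] :
    Module.Finite R (X.Homology R n) :=
  Module.Finite.of_surjective (X.homologyClass R n) (homologyClass_surjective n)

theorem finrank_homology_le {R : Type v} [DivisionRing R] :
    Module.finrank R (X.Homology R n) ≤ Nat.card (Fin (n + 1) → V) := by
  have h1 := LinearMap.finrank_le_finrank_of_surjective (f := X.homologyClass R n)
    (homologyClass_surjective n)
  have h2 := Submodule.finrank_le (X.cycles R n)
  have h3 : Module.finrank R (X.Chain R n) = Nat.card (X.simplices n) :=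
    Module.finrank_eq_nat_card_basis (Finsupp.basisSingleOne (R := R))
  have h4 : Nat.card (X.simplices n) ≤ Nat.card (Fin (n + 1) → V) :=
    Nat.card_le_card_of_injective _ Subtype.val_injective
  omega

end Dimension

end DirectedComplex

namespace DirectedFiltration

variable {V : Type u} [Finite V] {X : DirectedComplex V} {T : Set ℝ} (F : DirectedFiltration X T)
  (n : ℕ)

/-- The number of simplices of dimensions `n` and `n + 1` at a given time. -/
noncomputable def simplexCount (t : T) : ℕ :=
  ((F.complex t).simplices n).ncard + ((F.complex t).simplices (n + 1)).ncard

theorem monotone_simplexCount : Monotone (F.simplexCount n) := fun _ _ h =>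
  Nat.add_le_add (Set.ncard_le_ncard (F.mono h n) (Set.toFinite _))
    (Set.ncard_le_ncard (F.mono h (n + 1)) (Set.toFinite _))

theorem simplexCount_le (t : T) :
    F.simplexCount n t ≤ Nat.card (Fin (n + 1) → V) + Nat.card (Fin (n + 1 + 1) → V) :=
  Nat.add_le_add (Set.ncard_le_card _) (Set.ncard_le_card _)

theorem subset_of_simplexCount_eq {s t : T} (h : s ≤ t)
    (he : F.simplexCount n s = F.simplexCount n t) :
    (F.complex t).simplices n ⊆ (F.complex s).simplices n ∧
      (F.complex t).simplices (n + 1) ⊆ (F.complex s).simplices (n + 1) := by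
  have h1 := Set.ncard_le_ncard (F.mono h n) (Set.toFinite _)
  have h2 := Set.ncard_le_ncard (F.mono h (n + 1)) (Set.toFinite _)
  unfold simplexCount at he
  exact ⟨(Set.eq_of_subset_of_ncard_le (F.mono h n) (by omega) (Set.toFinite _)).ge,
    (Set.eq_of_subset_of_ncard_le (F.mono h (n + 1)) (by omega) (Set.toFinite _)).ge⟩

variable {Λ : Type v} [Semiring Λ]

theorem bijective_undirected_map {s t : T} (h : s ≤ t)
    (he : F.simplexCount n s = F.simplexCount n t) :
    Function.Bijective ((F.undirected Λ n).map h) :=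
  have hs := F.subset_of_simplexCount_eq n h he
  ⟨DirectedComplex.homologyMap_injective (F.mono h) hs.2,
    DirectedComplex.homologyMap_surjective (F.mono h) hs.1⟩

theorem bijective_directed_map {s t : T} (h : s ≤ t)
    (he : F.simplexCount n s = F.simplexCount n t) :
    Function.Bijective ((F.directed Λ n).map h) := by
  have hs := F.subset_of_simplexCount_eq n h he
  refine ⟨fun x y hxy => Subtype.ext ?_, fun y => ?_⟩
  · exact DirectedComplex.homologyMap_injective (F.mono h) hs.2 (congrArg Subtype.val hxy)
  · obtain ⟨x, hx, hxy⟩ := DirectedComplex.exists_directed_of_subset (F.mono h) hs.1 y.2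
    exact ⟨⟨x, hx⟩, Subtype.ext hxy⟩

end DirectedFiltration

theorem IsField.exists_divisionRing {R : Type v} [inst : Ring R] (hR : IsField R) :
    ∃ D : DivisionRing R, D.toRing = inst :=
  ⟨hR.toField.toDivisionRing, rfl⟩

theorem IsField.isNoetherianRing {R : Type v} [Ring R] (hR : IsField R) : IsNoetherianRing R := by
  obtain ⟨D, rfl⟩ := hR.exists_divisionRing
  infer_instance

theorem IsField.finrank_homology_le {V : Type u} [Finite V] {X : DirectedComplex V} {n : ℕ}
    {R : Type v} [Ring R] (hR : IsField R) :
    Module.finrank R (X.Homology R n) ≤ Nat.card (Fin (n + 1) → V) := by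
  obtain ⟨D, rfl⟩ := hR.exists_divisionRing
  exact DirectedComplex.finrank_homology_le

theorem IsField.nonempty_compatibleBases {R : Type v} [Ring R] (hR : IsField R) {T : Type w}
    [LinearOrder T] (M : PersistenceModule.{u} R T) (hfin : ∀ t, Module.Finite R (M.obj t))
    {q : T → ℕ} (hq : Monotone q) {m : ℕ} (hm : ∀ t, q t ≤ m)
    (hiso : ∀ {s t : T} (h : s ≤ t), q s = q t → Function.Bijective (M.map h)) :
    Nonempty M.CompatibleBases := by
  obtain ⟨D, rfl⟩ := hR.exists_divisionRing
  exact M.nonempty_compatibleBases_of_tame hq hm hiso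

theorem IsField.exists_isInducedMatching {R : Type v} [Ring R] (hR : IsField R) {T : Type w}
    [LinearOrder T] {M N : PersistenceModule.{u} R T} (𝓑 : M.CompatibleBases)
    (𝓒 : N.CompatibleBases) (f : M.Hom N) (hf : ∀ t, Function.Injective (f.app t)) (d : ℕ)
    (hfin : ∀ t, Module.Finite R (N.obj t)) (hd : ∀ t, Module.finrank R (N.obj t) ≤ d) :
    ∃ σ : 𝓑.Bar → 𝓒.Bar, IsInducedMatching 𝓑.life 𝓒.life σ := by
  obtain ⟨D, rfl⟩ := hR.exists_divisionRing
  exact 𝓑.exists_isInducedMatching_life 𝓒 f hf d hd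

theorem mainTheorem2 {V : Type u} [Finite V] {Λ : Type v} [Semiring Λ] [IsCancelAdd Λ]
    (hΛ : IsField (RingCompletion Λ)) {X : DirectedComplex V} {T : Set ℝ}
    (F : DirectedFiltration X T) (n : ℕ) :
    Nonempty (F.directed Λ n).CompatibleBases ∧
    Nonempty (F.undirected Λ n).CompatibleBases ∧
    (∀ t, Function.Injective ((F.inclusion Λ n).app t)) ∧
    ∀ (𝓓 : (F.directed Λ n).CompatibleBases) (𝓤 : (F.undirected Λ n).CompatibleBases),
      ∃ σ : 𝓓.Bar → 𝓤.Bar, IsInducedMatching 𝓓.life 𝓤.life σ := by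
  have := hΛ.isNoetherianRing
  have hU : ∀ t, Module.Finite (RingCompletion Λ) ((F.undirected Λ n).obj t) := fun t =>
    inferInstanceAs
      (Module.Finite (RingCompletion Λ) ((F.complex t).Homology (RingCompletion Λ) n))
  have hD : ∀ t, Module.Finite (RingCompletion Λ) ((F.directed Λ n).obj t) := fun t =>
    inferInstanceAs (Module.Finite (RingCompletion Λ) ((F.complex t).directedHomology Λ n))
  have hinj : ∀ t, Function.Injective ((F.inclusion Λ n).app t) := fun t =>
    Subtype.val_injective
  exact ⟨hΛ.nonempty_compatibleBases _ hD (F.monotone_simplexCount n) (F.simplexCount_le n)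
      (F.bijective_directed_map n),
    hΛ.nonempty_compatibleBases _ hU (F.monotone_simplexCount n) (F.simplexCount_le n)
      (F.bijective_undirected_map n), hinj,
    fun 𝓓 𝓤 => hΛ.exists_isInducedMatching 𝓓 𝓤 (F.inclusion Λ n) hinj _ hU
      fun _ => hΛ.finrank_homology_le⟩
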